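/- Call a real matrix totally positive (TP) if all its minors are nonnegative. Call a sequence $(a_n)_{n\ge 0}$ of polynomials in $\mathbb{R}[q]$ $q$-Stieltjes moment ($q$-SM) if every minor of its infinite Hankel matrix $[a_{i+j}]_{i,j\ge 0}$ is a polynomial in $q$ with nonnegative coefficients. With $\mathcal{L}[a_i]=a_{i-1}a_{i+1}-a_i^2$, call it $3$-$q$-log-convex if, for each $m\le 3$, all terms of $\mathcal{L}^m[a_i]$ $(i\ge m)$ have nonnegative coefficients. The same terms are used for sequences $(a_n)_{n\ge1}$ after re-indexing. A real sequence $(a_n)_{n\ge 0}$ is a Stieltjes moment (SM) sequence if there is a nonnegative measure $\mu$ on $[0,\infty)$ such that $a_n=\int_0^\infty x^n\,d\mu(x)$ (with all these integrals finite) for all $n\ge 0$. A convolution $(x,y)\mapsto z$ preserves the SM property if $z$ is SM whenever $x=(x_n)_{n\ge0}$ and $y=(y_n)_{n\ge0}$ both are. The convention $0^0=1$ is used, and entries of the triangles below with $k>n$ are $0$. **Proposition.** (i) The matrices $\left[\binom{n}{k}k^{n-k}\right]_{n,k\ge 0}$ and $\left[\binom{n-1}{k-1}n^{n-k}\right]_{n,k\ge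 1}$ are TP. (ii) The matrices $\left[\binom{n}{k}k^{n-k}\,k!\right]_{n,k\ge 0}$ and $\left[\binom{n-1}{k-1}n^{n-k}\,k!\right]_{n,k\ge 1}$ are TP. (iii) Let $\mathcal{I}_0(q)=1$ and $\mathcal{I}_n(q)=\sum_{k=1}^n\binom{n-1}{k-1}n^{n-k}q^k$ for $n\ge 1$. The sequence $(\mathcal{I}_n(q))_{n\ge 0}$ is $q$-SM and $3$-$q$-log-convex. (iv) The sequence $\left((1+qn)^{n-1}\right)_{n\ge 1}$ is $q$-SM and $3$-$q$-log-convex. (v) The sequence $(n^{n-1})_{n\ge 1}$ is SM. (vi) The convolution given by $z_0=x_0y_0$ and $z_n=\sum_{k=1}^n\binom{n-1}{k-1}n^{n-k}x_ky_{n-k}$ for $n\ge 1$, and the convolution $z_n=\sum_{k=0}^n\binom{n}{k}(n+1)^{n-k}x_ky_{n-k}$ for $n\ge 0$, both preserve the SM property. -/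

import Mathlib

open Polynomial

/-- A (possibly infinite) real matrix is totally positive if all its minors, taken along
increasing rows and increasing columns, are nonnegative. -/
def IsTotallyPositive {m n : Type*} [Preorder m] [Preorder n] (M : Matrix m n ℝ) : Prop :=
  ∀ (r : ℕ) (rows : Fin r → m) (cols : Fin r → n), StrictMono rows → StrictMono cols →
    0 ≤ (M.submatrix rows cols).det

/-- A real polynomial in `q` all of whose coefficients are nonnegative. -/
def HasNonnegCoeffs (p : ℝ[X]) : Prop := ∀ i : ℕ, 0 ≤ p.coeff i

/-- `q`-total positivity: every minor is a polynomial in `q` with nonnegative coefficients. -/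
def IsQTotallyPositive {m n : Type*} [Preorder m] [Preorder n] (M : Matrix m n ℝ[X]) : Prop :=
  ∀ (r : ℕ) (rows : Fin r → m) (cols : Fin r → n), StrictMono rows → StrictMono cols →
    HasNonnegCoeffs (M.submatrix rows cols).det

/-- The infinite Hankel matrix `[a_{i+j}]_{i,j ≥ 0}`. -/
def hankelMatrix {R : Type*} (a : ℕ → R) : Matrix ℕ ℕ R := Matrix.of fun i j => a (i + j)

/-- A `q`-Stieltjes moment sequence of polynomials: its Hankel matrix is `q`-totally positive. -/
def IsQStieltjesMoment (a : ℕ → ℝ[X]) : Prop := IsQTotallyPositive (hankelMatrix a)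

/-- The operator `𝓛[a_i] = a_{i-1} a_{i+1} - a_i ^ 2`, for `i ≥ 1`, re-indexed to start at `0`. -/
noncomputable def logConvexOp (a : ℕ → ℝ[X]) : ℕ → ℝ[X] :=
  fun i => a i * a (i + 2) - a (i + 1) ^ 2

/-- `k`-`q`-log-convexity: for every `m ≤ k`, all terms of `𝓛^m[a]` have nonnegative
coefficients. -/
def IsKQLogConvex (k : ℕ) (a : ℕ → ℝ[X]) : Prop :=
  ∀ m ≤ k, ∀ i : ℕ, HasNonnegCoeffs (logConvexOp^[m] a i)

/-- A Stieltjes moment sequence: `a_k = ∫_0^∞ x^k dμ(x)` for a nonnegative measure `μ`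
all of whose moments are finite. -/
def IsStieltjesMoment (a : ℕ → ℝ) : Prop :=
  ∃ μ : MeasureTheory.Measure ℝ, ∀ k : ℕ,
    MeasureTheory.IntegrableOn (fun x : ℝ => x ^ k) (Set.Ici 0) μ ∧
      a k = ∫ x in Set.Ici (0 : ℝ), x ^ k ∂μ

/-- The convolution `z_n = ∑_{k=0}^n A_{n,k} x_k y_{n-k}` given by a triangle `A`. -/
noncomputable def triangleConvolution (A : ℕ → ℕ → ℝ) (x y : ℕ → ℝ) : ℕ → ℝ :=
  fun n => ∑ k ∈ Finset.range (n + 1), A n k * x k * y (n - k)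

/-- The `A`-convolution maps each pair of Stieltjes moment sequences to such a sequence. -/
def ConvolutionPreservesSM (A : ℕ → ℕ → ℝ) : Prop :=
  ∀ x y : ℕ → ℝ, IsStieltjesMoment x → IsStieltjesMoment y →
    IsStieltjesMoment (triangleConvolution A x y)

/-- The numbers `binom(n-1, k-1) n^(n-k)` for `n, k ≥ 1`, extended to `n, k ≥ 0` by
`1` at `(0, 0)` and `0` elsewhere on the border: the coefficient of `q^k t^n / n!` in
`exp (q T(t))`, where `T(t) = ∑_{n ≥ 1} n^(n-1) t^n / n!`. -/
noncomputable def inverseIdempotent (n k : ℕ) : ℝ :=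
  if n = 0 ∧ k = 0 then 1
  else if n = 0 ∨ k = 0 then 0
  else ((n - 1).choose (k - 1) : ℝ) * (n : ℝ) ^ (n - k)

/-- The row polynomials: `1` for `n = 0`, and `∑_{k=1}^n binom(n-1, k-1) n^(n-k) q^k` for
`n ≥ 1`. -/
noncomputable def inverseIdempotentPoly (n : ℕ) : ℝ[X] :=
  if n = 0 then 1
  else ∑ k ∈ Finset.Icc 1 n, C (((n - 1).choose (k - 1) : ℝ) * (n : ℝ) ^ (n - k)) * X ^ k

/-! Everything on total positivity is proved for minors lying in a subsemiring `S`, so that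
nonnegative reals and polynomials with nonnegative coefficients are treated at once. If the minors
of `P` lie in `S`, so do those of the matrix with rows `(P ^ n) 0 ·`, by Cauchy–Binet and bordering;
and `(P ^ (i + j)) 0 0` is the sum over `k` of `(P ^ i) 0 k * (P ^ j) k 0`, which factors the Hankel
matrix of `(P ^ n) 0 0`.

Two triangles carry the result: `abelTriangle x y`, with first column `x (x + n y)^(n-1)`, and
`treeTriangle x y`, with first column `(x + (n+1) y)^n`. The matrix `B = pascal y * pathProduct ((i
+ 1) y)` sends row `n` of the Abel triangle to row `n` of the tree triangle, and `D = x + shift`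
sends that to row `n + 1` of the Abel triangle. So `B * D` and `D * B` produce the two triangles,
and both have good minors. The choices `(x, y) = (q, 1)`, `(1, q)`, `(0, 1)` give (iii), (iv), and
(v) with the second matrices of (i) and (ii). The idempotent triangle has its own production matrix,
read along columns. Log-convexity up to order 3 follows from the Hankel minors of size at most 4.

For moments, Hankel minors make the Riesz functional nonnegative on `q²` and `X q²`, hence on
polynomials nonnegative on the half-line; M. Riesz extension and Riesz–Markov–Kakutani then give a
measure. For (vi), bilinearity reduces the convolutions to the point-mass sequences `s^n`, `t^n`,
whose convolutions are the two first columns above at `(x, y) = (s, t)`. -/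

section

/-! ### Cauchy–Binet and minors in a subsemiring. -/

namespace Matrix

/-- The **Cauchy–Binet formula**. -/
theorem det_mul_eq_sum_orderEmb {R n : Type*} [CommRing R] [Fintype n] [LinearOrder n] {r : ℕ}
    (A : Matrix (Fin r) n R) (B : Matrix n (Fin r) R) :
    (A * B).det = ∑ f : Fin r ↪o n, (A.submatrix id f).det * (B.submatrix f id).det := by
  classical
  have expand : (A * B).det = ∑ p : Fin r → n, (∏ i, A i (p i)) * (B.submatrix p id).det := by
    have h : (A * B) = fun i => ∑ j, A i j • B j := by
      ext i k
      simp [Matrix.mul_apply, Finset.sum_apply]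
    rw [h]
    change detRowAlternating (fun i => ∑ j, A i j • B j) = _
    rw [← AlternatingMap.coe_multilinearMap, MultilinearMap.map_sum]
    refine Finset.sum_congr rfl fun p _ => ?_
    rw [MultilinearMap.map_smul_univ]
    rfl
  rw [expand]
  have term : ∀ f : Fin r ↪o n, (A.submatrix id f).det * (B.submatrix f id).det =
      ∑ σ : Equiv.Perm (Fin r), (∏ i, A i (f (σ i))) * (B.submatrix (f ∘ σ) id).det := by
    intro f
    rw [← det_transpose (A.submatrix id f), det_apply', Finset.sum_mul]
    refine Finset.sum_congr rfl fun σ _ => ?_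
    have : B.submatrix (f ∘ σ) id = (B.submatrix f id).submatrix σ id := rfl
    rw [this, det_permute]
    simp [transpose_apply, submatrix_apply]
    ring
  simp_rw [term]
  rw [← Finset.sum_product', Finset.univ_product_univ]
  symm
  refine Finset.sum_of_injOn (fun fσ : (Fin r ↪o n) × Equiv.Perm (Fin r) => fσ.1 ∘ fσ.2)
    ?_ (by simp) ?_ (by simp)
  · rintro ⟨f, σ⟩ - ⟨g, τ⟩ - h
    have hr : Set.range f = Set.range g := by
      have := congrArg Set.range h
      simpa [Set.range_comp, Equiv.range_eq_univ] using this
    have hfg : f = g := by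
      apply DFunLike.coe_injective
      exact (StrictMono.range_inj f.strictMono g.strictMono).1 hr
    subst hfg
    have hσ : σ = τ := by
      refine Equiv.ext fun i => ?_
      have := congrFun h i
      simpa using this
    rw [hσ]
  · intro p _ hp
    have hinj : ¬ Function.Injective p := by
      intro hinj
      apply hp
      have hc : (Finset.univ.image p).card = r := by
        rw [Finset.card_image_of_injective _ hinj]; simp
      set f := (Finset.univ.image p).orderEmbOfFin hc
      have hmem : ∀ i, ∃ j, f j = p i := by
        intro i
        have : p i ∈ Set.range f := by
          rw [Finset.range_orderEmbOfFin]; simp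
        exact this
      choose σ hσ using hmem
      have hσi : Function.Injective σ := fun a b hab => hinj (by rw [← hσ, ← hσ, hab])
      refine ⟨(f, Equiv.ofBijective σ (Finite.injective_iff_bijective.1 hσi)), by simp, ?_⟩
      funext i
      simp [hσ]
    rw [Function.Injective] at hinj
    push Not at hinj
    obtain ⟨i, j, hij, hne⟩ := hinj
    rw [det_zero_of_row_eq hne (by funext k; simp [hij]), mul_zero]

/-- A determinant whose first row vanishes off the corner is the product of the corner and of
the complementary minor. -/
theorem det_eq_corner_mul_of_row {R : Type*} [CommRing R] {r : ℕ}
    (M : Matrix (Fin (r + 1)) (Fin (r + 1)) R) (h : ∀ j : Fin r, M 0 j.succ = 0) :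
    M.det = M 0 0 * (M.submatrix Fin.succ Fin.succ).det := by
  rw [det_succ_row_zero, Fin.sum_univ_succ]
  simp [h]

theorem det_eq_corner_mul_of_col {R : Type*} [CommRing R] {r : ℕ}
    (M : Matrix (Fin (r + 1)) (Fin (r + 1)) R) (h : ∀ i : Fin r, M i.succ 0 = 0) :
    M.det = M 0 0 * (M.submatrix Fin.succ Fin.succ).det := by
  rw [← det_transpose, det_eq_corner_mul_of_row Mᵀ h, ← det_transpose (M.submatrix _ _)]
  rfl

/-- All minors, along increasing rows and columns, lie in the subsemiring `S`. -/
def MinorsMem {R m n : Type*} [CommRing R] [Preorder m] [Preorder n] (S : Subsemiring R)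
    (M : Matrix m n R) : Prop :=
  ∀ (r : ℕ) (rows : Fin r → m) (cols : Fin r → n), StrictMono rows → StrictMono cols →
    (M.submatrix rows cols).det ∈ S

namespace MinorsMem

variable {R : Type*} [CommRing R] {S : Subsemiring R}

theorem transpose {m n : Type*} [Preorder m] [Preorder n] {M : Matrix m n R}
    (h : M.MinorsMem S) : Mᵀ.MinorsMem S := by
  intro r rows cols hr hc
  rw [← det_transpose]
  exact h r cols rows hc hr

theorem submatrix {m n m' n' : Type*} [Preorder m] [Preorder n] [Preorder m'] [Preorder n']
    {M : Matrix m n R} (h : M.MinorsMem S) {f : m' → m} {g : n' → n} (hf : StrictMono f)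
    (hg : StrictMono g) : (M.submatrix f g).MinorsMem S :=
  fun r _ _ hr hc => h r _ _ (hf.comp hr) (hg.comp hc)

theorem mul {m n p : Type*} [Preorder m] [Fintype n] [LinearOrder n] [Preorder p]
    {A : Matrix m n R} {B : Matrix n p R} (hA : A.MinorsMem S) (hB : B.MinorsMem S) :
    (A * B).MinorsMem S := by
  intro r rows cols hr hc
  have : (A * B).submatrix rows cols = A.submatrix rows id * B.submatrix id cols := rfl
  rw [this, det_mul_eq_sum_orderEmb]
  exact sum_mem fun f _ => mul_mem (hA r _ _ hr f.strictMono) (hB r _ _ f.strictMono hc)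

theorem scale_rows {m n : Type*} [Preorder m] [Preorder n] {M : Matrix m n R}
    (h : M.MinorsMem S) {c : m → R} (hc : ∀ i, c i ∈ S) :
    (Matrix.of fun i j => c i * M i j).MinorsMem S := by
  intro r rows cols hr hcol
  have : (Matrix.of fun i j => c i * M i j).submatrix rows cols =
      Matrix.of fun i j => c (rows i) * M.submatrix rows cols i j := rfl
  rw [this, det_mul_column]
  exact mul_mem (prod_mem fun i _ => hc _) (h r _ _ hr hcol)

theorem scale_cols {m n : Type*} [Preorder m] [Preorder n] {M : Matrix m n R}
    (h : M.MinorsMem S) {c : n → R} (hc : ∀ i, c i ∈ S) :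
    (Matrix.of fun i j => M i j * c j).MinorsMem S := by
  have := (h.transpose.scale_rows hc).transpose
  convert this using 1
  ext i j
  simp [mul_comm]

/-- Total positivity of an infinite matrix can be checked on its leading blocks. -/
theorem of_leading {M : Matrix ℕ ℕ R}
    (h : ∀ N, (M.submatrix (Fin.val : Fin N → ℕ) (Fin.val : Fin N → ℕ)).MinorsMem S) :
    M.MinorsMem S := by
  intro r rows cols hr hc
  set N := (∑ i, rows i) + (∑ i, cols i) + 1
  have h1 : ∀ i, rows i < N := fun i => by
    have := Finset.single_le_sum (f := rows) (fun _ _ => Nat.zero_le _) (Finset.mem_univ i)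
    omega
  have h2 : ∀ i, cols i < N := fun i => by
    have := Finset.single_le_sum (f := cols) (fun _ _ => Nat.zero_le _) (Finset.mem_univ i)
    omega
  exact h N r (fun i => ⟨rows i, h1 i⟩) (fun i => ⟨cols i, h2 i⟩) (fun _ _ hij => hr hij)
    (fun _ _ hij => hc hij)

/-- Putting the first unit vector on top of a totally positive matrix. -/
theorem of_succ {M N : ℕ} {A : Matrix (Fin (M + 1)) (Fin (N + 1)) R}
    (h0 : A 0 0 = 1) (h0' : ∀ j : Fin N, A 0 j.succ = 0)
    (h : (A.submatrix Fin.succ id).MinorsMem S) : A.MinorsMem S := by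
  have key : ∀ (r : ℕ) (rows : Fin r → Fin (M + 1)) (cols : Fin r → Fin (N + 1)),
      StrictMono rows → StrictMono cols → (∀ i, rows i ≠ 0) →
      (A.submatrix rows cols).det ∈ S := by
    intro r rows cols hr hc hne
    have := h r (fun i => (rows i).pred (hne i)) cols
      (fun _ _ hij => by simpa using hr hij) hc
    convert this using 2
    ext i j
    simp
  intro r rows cols hr hc
  by_cases hz : ∀ i, rows i ≠ 0
  · exact key r rows cols hr hc hz
  · push Not at hz
    obtain ⟨i, hi⟩ := hz
    obtain _ | r := r
    · exact i.elim0
    have hpos : ∀ {n k : ℕ} {f : Fin (n + 1) → Fin (k + 1)}, StrictMono f →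
        ∀ j : Fin n, f j.succ ≠ 0 := fun hf j => by
      have := hf (Fin.succ_pos j)
      exact (lt_of_le_of_lt (Fin.zero_le _) this).ne'
    have h00 : rows 0 = 0 := by
      have := hr.monotone (Fin.zero_le i)
      rw [hi] at this
      exact le_antisymm this (Fin.zero_le _)
    rw [det_eq_corner_mul_of_row]
    · refine mul_mem ?_ ?_
      · rw [submatrix_apply, h00]
        by_cases hc0 : cols 0 = 0
        · rw [hc0, h0]; exact one_mem _
        · obtain ⟨j, hj⟩ := Fin.exists_succ_eq.2 hc0
          rw [← hj, h0']; exact zero_mem _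
      · exact key r (rows ∘ Fin.succ) (cols ∘ Fin.succ) (hr.comp (Fin.strictMono_succ))
          (hc.comp (Fin.strictMono_succ)) (hpos hr)
    · intro j
      obtain ⟨k, hk⟩ := Fin.exists_succ_eq.2 (hpos hc j)
      rw [submatrix_apply, h00, ← hk, h0']

/-- The matrix whose rows are the first rows of the powers of `P`. -/
theorem pow_zero_row {N : ℕ} {P : Matrix (Fin (N + 1)) (Fin (N + 1)) R} (hP : P.MinorsMem S)
    (M : ℕ) : (Matrix.of fun (n : Fin M) k => (P ^ (n : ℕ)) 0 k).MinorsMem S := by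
  induction M with
  | zero =>
    intro r rows cols _ _
    obtain _ | r := r
    · simp
    · exact (rows 0).elim0
  | succ M ih =>
    apply of_succ
    · simp
    · intro j; simp [(Fin.succ_ne_zero j).symm]
    -- Without its first row the matrix is the one with `M` rows, times `P`.
    · convert ih.mul hP using 1
      ext i j
      simp [pow_succ, Matrix.mul_apply]

theorem pow_zero_col {N : ℕ} {P : Matrix (Fin (N + 1)) (Fin (N + 1)) R} (hP : P.MinorsMem S)
    (M : ℕ) : (Matrix.of fun k (n : Fin M) => (P ^ (n : ℕ)) k 0).MinorsMem S := by
  have := (hP.transpose.pow_zero_row M).transpose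
  convert this using 1
  ext i j
  simp [← transpose_pow]

end MinorsMem

/-- The upper bidiagonal matrix with diagonal `d` and superdiagonal `1`. -/
def bidiagonal {R : Type*} [CommRing R] (d : ℕ → R) : Matrix ℕ ℕ R :=
  Matrix.of fun i j => if j = i then d i else if j = i + 1 then 1 else 0

/-- The corner always splits off: if `rows 0 < cols 0`, later columns lie beyond the superdiagonal
of row `rows 0`; otherwise later rows lie below the diagonal in column `cols 0`. -/
theorem minorsMem_bidiagonal {R : Type*} [CommRing R] {S : Subsemiring R} {d : ℕ → R}
    (hd : ∀ i, d i ∈ S) : (bidiagonal d).MinorsMem S := by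
  intro r
  induction r with
  | zero => intros; simp
  | succ r ih =>
    intro rows cols hr hc
    have hr' : ∀ i : Fin r, rows 0 < rows i.succ := fun i => hr (Fin.succ_pos i)
    have hc' : ∀ i : Fin r, cols 0 < cols i.succ := fun i => hc (Fin.succ_pos i)
    have h00 : bidiagonal d (rows 0) (cols 0) ∈ S := by
      simp only [bidiagonal, Matrix.of_apply]
      split_ifs
      exacts [hd _, one_mem _, zero_mem _]
    have hrec : (bidiagonal d (rows 0) (cols 0)) * (((bidiagonal d).submatrix rows cols).submatrix
        Fin.succ Fin.succ).det ∈ S :=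
      mul_mem h00 (ih _ _ (hr.comp Fin.strictMono_succ) (hc.comp Fin.strictMono_succ))
    by_cases h : rows 0 < cols 0
    · rw [det_eq_corner_mul_of_row]
      · exact hrec
      · intro j
        have := hc' j
        simp only [submatrix_apply, bidiagonal, Matrix.of_apply]
        rw [if_neg (by omega), if_neg (by omega)]
    · rw [det_eq_corner_mul_of_col]
      · exact hrec
      · intro j
        have := hr' j
        simp only [submatrix_apply, bidiagonal, Matrix.of_apply]
        rw [if_neg (by omega), if_neg (by omega)]

end Matrix

/-! ### Production matrices; the Abel and tree triangles. -/

namespace Matrix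

section Triangles

variable {R : Type*} [CommRing R]

/-- The leading block of an infinite matrix with rows and columns `0, …, N`. -/
def leadingBlock (N : ℕ) (A : Matrix ℕ ℕ R) : Matrix (Fin (N + 1)) (Fin (N + 1)) R :=
  A.submatrix Fin.val Fin.val

theorem MinorsMem.leadingBlock {S : Subsemiring R} {A : Matrix ℕ ℕ R} (h : A.MinorsMem S)
    (N : ℕ) : (leadingBlock N A).MinorsMem S :=
  h.submatrix (fun _ _ hij => hij) (fun _ _ hij => hij)

theorem MinorsMem.of_leadingBlock {S : Subsemiring R} {A : Matrix ℕ ℕ R}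
    (h : ∀ N, (Matrix.leadingBlock N A).MinorsMem S) : A.MinorsMem S :=
  MinorsMem.of_leading fun N =>
    (h N).submatrix (f := Fin.castSucc) (g := Fin.castSucc) Fin.strictMono_castSucc
      Fin.strictMono_castSucc

theorem vecMul_leadingBlock (N : ℕ) (A : Matrix ℕ ℕ R) (v : ℕ → R) (k : Fin (N + 1)) :
    ((fun j : Fin (N + 1) => v j) ᵥ* leadingBlock N A) k =
      ∑ j ∈ Finset.range (N + 1), v j * A j k := by
  rw [Finset.sum_range]
  rfl

/-- If the rows of a triangle are produced by `P`, they are the first rows of the powers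
of `P`. -/
theorem pow_zero_row_eq {N : ℕ} {P : Matrix (Fin (N + 1)) (Fin (N + 1)) R} {o : ℕ → ℕ → R}
    (h0 : ∀ k, o 0 k = if k = 0 then 1 else 0)
    (h : ∀ n < N, (fun j : Fin (N + 1) => o n j) ᵥ* P = fun j : Fin (N + 1) => o (n + 1) j) :
    ∀ n ≤ N, ∀ k : Fin (N + 1), (P ^ n) 0 k = o n k := by
  intro n
  induction n with
  | zero =>
    intro _ k
    rw [h0, pow_zero, Matrix.one_apply]
    exact if_congr (by rw [Fin.ext_iff]; exact eq_comm) rfl rfl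
  | succ n ih =>
    intro hn k
    have := congrFun (h n (by omega)) k
    rw [← this, pow_succ, Matrix.mul_apply]
    simp only [vecMul, dotProduct]
    exact Finset.sum_congr rfl fun j _ => by rw [ih (by omega) j]

theorem minorsMem_of_production {S : Subsemiring R} {o : Matrix ℕ ℕ R}
    (P : ∀ N : ℕ, Matrix (Fin (N + 1)) (Fin (N + 1)) R) (hP : ∀ N, (P N).MinorsMem S)
    (h : ∀ N, ∀ n ≤ N, ∀ k : Fin (N + 1), (P N ^ n) 0 k = o n k) : o.MinorsMem S := by
  apply MinorsMem.of_leadingBlock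
  intro N
  have := (hP N).pow_zero_row (N + 1)
  convert this using 1
  ext i j
  exact (h N i (by omega) j).symm

/-- Split `P ^ (i + j)` as `P ^ i * P ^ j`. Truncation at `2 * N` keeps `i + j` in range for a
Hankel block with indices up to `N`. -/
theorem minorsMem_hankelMatrix_of_production {S : Subsemiring R} {a : ℕ → R}
    (P : ∀ N : ℕ, Matrix (Fin (N + 1)) (Fin (N + 1)) R) (hP : ∀ N, (P N).MinorsMem S)
    (h : ∀ N, ∀ n ≤ N, (P N ^ n) 0 0 = a n) : (hankelMatrix a).MinorsMem S := by
  apply MinorsMem.of_leadingBlock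
  intro N
  have := ((hP (2 * N)).pow_zero_row (N + 1)).mul ((hP (2 * N)).pow_zero_col (N + 1))
  convert this using 1
  ext i j
  have hij := h (2 * N) (i + j) (by omega)
  rw [pow_add, Matrix.mul_apply] at hij
  simpa [leadingBlock, hankelMatrix, Matrix.mul_apply] using hij.symm

/-- The weighted Pascal triangle `binom(n, k) a^(n-k)`. -/
def pascal (a : R) : Matrix ℕ ℕ R := Matrix.of fun n k => (n.choose k : R) * a ^ (n - k)

theorem pascal_zero (a : R) (k : ℕ) : pascal a 0 k = if k = 0 then 1 else 0 := by
  obtain _ | k := k <;> simp [pascal]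

theorem pascal_eq_zero (a : R) {n k : ℕ} (h : n < k) : pascal a n k = 0 := by
  simp [pascal, Nat.choose_eq_zero_of_lt h]

theorem pascal_succ_zero (a : R) (n : ℕ) : pascal a (n + 1) 0 = a * pascal a n 0 := by
  simp [pascal, pow_succ']

theorem pascal_succ_succ (a : R) (n k : ℕ) :
    pascal a (n + 1) (k + 1) = a * pascal a n (k + 1) + pascal a n k := by
  rcases lt_or_ge n (k + 1) with h | h
  · rw [pascal_eq_zero a h]
    simp [pascal, Nat.choose_succ_succ, Nat.choose_eq_zero_of_lt h]
  · obtain ⟨m, rfl⟩ := Nat.exists_eq_add_of_le h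
    simp only [pascal, Matrix.of_apply, Nat.choose_succ_succ]
    rw [show k + 1 + m + 1 - (k + 1) = m + 1 by omega, show k + 1 + m - (k + 1) = m by omega,
      show k + 1 + m - k = m + 1 by omega]
    push_cast
    ring

/-- Compare coefficients in the expansion of `((X + b) + a) ^ n`. -/
theorem sum_pascal_mul_pascal (a b : R) {n N : ℕ} (hn : n ≤ N) (k : ℕ) :
    ∑ j ∈ Finset.range (N + 1), pascal a n j * pascal b j k = pascal (a + b) n k := by
  have h := congrArg (fun p : R[X] => p.coeff k) (add_pow (X + C b) (C a) n)
  rw [add_assoc, ← C_add, add_comm b a] at h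
  simp only [coeff_X_add_C_pow, finsetSum_coeff] at h
  rw [← Finset.sum_subset (Finset.range_subset_range.2 (Nat.succ_le_succ hn))]
  · simp only [pascal, Matrix.of_apply]
    rw [mul_comm, h]
    refine Finset.sum_congr rfl fun j _ => ?_
    rw [← C_pow, ← C_eq_natCast, coeff_mul_C, coeff_mul_C, coeff_X_add_C_pow]
    ring
  · intro j _ hj
    rw [pascal_eq_zero a (by simpa using hj), zero_mul]

/-- Right multiplication by a bidiagonal matrix. -/
theorem sum_mul_bidiagonal_zero (d : ℕ → R) (v : ℕ → R) (N : ℕ) :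
    ∑ j ∈ Finset.range (N + 1), v j * bidiagonal d j 0 = v 0 * d 0 := by
  rw [Finset.sum_range_succ']
  simp [bidiagonal]

theorem sum_mul_bidiagonal_succ (d : ℕ → R) (v : ℕ → R) {N k : ℕ} (hk : k + 1 ≤ N) :
    ∑ j ∈ Finset.range (N + 1), v j * bidiagonal d j (k + 1) =
      v (k + 1) * d (k + 1) + v k := by
  have hne : k + 1 ≠ k := by omega
  rw [← Finset.sum_subset (s₁ := {k, k + 1})]
  · rw [Finset.sum_pair (by omega)]
    simp [bidiagonal, add_comm]
  · intro j; simp; omega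
  · intro j _ hj
    simp only [Finset.mem_insert, Finset.mem_singleton, not_or] at hj
    simp only [bidiagonal, Matrix.of_apply]
    rw [if_neg (by omega), if_neg (by omega), mul_zero]

theorem minorsMem_pascal {S : Subsemiring R} {a : R} (ha : a ∈ S) : (pascal a).MinorsMem S := by
  refine minorsMem_of_production (fun N => leadingBlock N (bidiagonal fun _ => a))
    (fun N => (minorsMem_bidiagonal fun _ => ha).leadingBlock N) fun N => ?_
  refine pow_zero_row_eq (pascal_zero a) fun n _ => ?_
  ext k
  rw [vecMul_leadingBlock]
  obtain ⟨k, hk⟩ := k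
  obtain _ | k := k
  · simp only [sum_mul_bidiagonal_zero, pascal_succ_zero, mul_comm]
  · simp only [sum_mul_bidiagonal_succ _ _ (Nat.lt_succ_iff.1 hk), pascal_succ_succ, mul_comm]

/-- The lower triangular matrix with entries `c k * c (k + 1) * ⋯ * c (n - 1)`. -/
def pathProduct (c : ℕ → R) : Matrix ℕ ℕ R :=
  Matrix.of fun n k => if k ≤ n then ∏ i ∈ Finset.Ico k n, c i else 0

theorem pathProduct_succ_succ (c : ℕ → R) (n k : ℕ) :
    pathProduct c (n + 1) (k + 1) = pathProduct (fun i => c (i + 1)) n k := by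
  simp only [pathProduct, Matrix.of_apply, add_le_add_iff_right]
  congr 1
  rw [Finset.prod_Ico_add' c k n 1]

theorem pathProduct_succ_zero (c : ℕ → R) (n : ℕ) :
    pathProduct c (n + 1) 0 = pathProduct (fun i => c (i + 1)) n 0 * c 0 := by
  simp only [pathProduct, Matrix.of_apply, Nat.zero_le, if_true, ← Finset.range_eq_Ico]
  rw [Finset.prod_range_succ']

theorem pathProduct_succ_left (c : ℕ → R) {n k : ℕ} (h : k ≤ n) :
    pathProduct c (n + 1) k = pathProduct c n k * c n := by
  simp only [pathProduct, Matrix.of_apply]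
  rw [if_pos h, if_pos (by omega), Finset.prod_Ico_succ_top h]

theorem pathProduct_self (c : ℕ → R) (n : ℕ) : pathProduct c n n = 1 := by
  simp [pathProduct]

theorem pathProduct_eq_zero (c : ℕ → R) {n k : ℕ} (h : n < k) : pathProduct c n k = 0 := by
  simp [pathProduct, h]

/-- Below its first row, which is a unit vector, the matrix equals the one for the shifted weights
times a bidiagonal matrix with diagonal `c 0, 0, 0, …`. Hence the induction on the number of rows
for all `c` together. -/
theorem minorsMem_pathProduct {S : Subsemiring R} {c : ℕ → R} (hc : ∀ i, c i ∈ S) :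
    (pathProduct c).MinorsMem S := by
  have key : ∀ (M N : ℕ) (c : ℕ → R), (∀ i, c i ∈ S) →
      ((pathProduct c).submatrix (Fin.val : Fin M → ℕ)
        (Fin.val : Fin (N + 1) → ℕ)).MinorsMem S := by
    intro M N
    induction M with
    | zero =>
      intro c _ r rows cols _ _
      obtain _ | r := r
      · simp
      · exact (rows 0).elim0
    | succ M ih =>
      intro c hc
      apply MinorsMem.of_succ
      · simp [pathProduct]
      · intro j; simp [pathProduct]
      · set d : ℕ → R := fun i => if i = 0 then c 0 else 0
        have hd : ∀ i, d i ∈ S := fun i => by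
          simp only [d]; split_ifs
          exacts [hc 0, zero_mem _]
        have := (ih (fun i => c (i + 1)) fun i => hc _).mul
          ((minorsMem_bidiagonal hd).leadingBlock N)
        convert this using 1
        ext i k
        have hv := vecMul_leadingBlock N (bidiagonal d) (pathProduct (fun i => c (i + 1)) i) k
        rw [Matrix.mul_apply]
        simp only [vecMul, dotProduct] at hv
        simp only [submatrix_apply, Fin.val_succ, id]
        rw [hv]
        obtain ⟨k, hk⟩ := k
        obtain _ | k := k
        · simp only [sum_mul_bidiagonal_zero, pathProduct_succ_zero, d, if_true]
        · simp only [sum_mul_bidiagonal_succ _ _ (Nat.lt_succ_iff.1 hk), pathProduct_succ_succ, d]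
          simp
  exact MinorsMem.of_leadingBlock fun N => key (N + 1) N c hc

/-- The triangle `binom(n, k) (x + k y) (x + n y)^(n - k - 1)`. -/
def abelTriangle (x y : R) : Matrix ℕ ℕ R :=
  -- This agrees with the closed formula because `n * binom(n-1, k) = (n-k) * binom(n, k)`; the
  -- difference avoids the exponent `-1` at `k = n`.
  Matrix.of fun n k => pascal (x + n * y) n k - n * y * pascal (x + n * y) (n - 1) k

/-- The triangle `binom(n, k) (x + (n + 1) y)^(n - k)`. -/
def treeTriangle (x y : R) : Matrix ℕ ℕ R :=
  Matrix.of fun n k => pascal (x + (n + 1) * y) n k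

theorem sum_abelTriangle_mul_pascal (x y : R) {n N : ℕ} (hn : n ≤ N) (k : ℕ) :
    ∑ j ∈ Finset.range (N + 1), abelTriangle x y n j * pascal y j k =
      abelTriangle (x + y) y n k := by
  simp only [abelTriangle, Matrix.of_apply, sub_mul, Finset.sum_sub_distrib, mul_assoc,
    ← Finset.mul_sum]
  rw [sum_pascal_mul_pascal _ _ hn, sum_pascal_mul_pascal _ _ (by omega : n - 1 ≤ N)]
  rw [show x + n * y + y = x + y + n * y by ring]

theorem natCast_mul_pascal_pred (a : R) (n j : ℕ) :
    n * pascal a (n - 1) j = (j + 1) * pascal a n (j + 1) := by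
  obtain _ | n := n
  · simp [pascal]
  · simp only [pascal, Matrix.of_apply, Nat.add_sub_cancel]
    have := congrArg (Nat.cast (R := R)) (Nat.add_one_mul_choose_eq n j)
    push_cast at this
    rw [← mul_assoc, ← mul_assoc, Nat.add_sub_add_right, Nat.cast_succ, this]
    ring

/-- The sum telescopes: with `f j = pascal a n j * pathProduct c j k`, the term for `j ≥ k` is `f j
- f (j + 1)`, and `f k = pascal a n k` while `f (N + 1) = 0`. -/
theorem sum_abelTriangle_mul_pathProduct (x y : R) {n N k : ℕ} (hn : n ≤ N) (hk : k ≤ N) :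
    ∑ j ∈ Finset.range (N + 1),
      abelTriangle (x + y) y n j * pathProduct (fun i : ℕ => (i + 1) * y) j k =
      treeTriangle x y n k := by
  set c : ℕ → R := fun i : ℕ => (i + 1) * y with hc
  set a := x + (n + 1) * y with ha
  have hpart : ∀ m, ∑ j ∈ Finset.range m, abelTriangle (x + y) y n j * pathProduct c j k =
      if m ≤ k then 0 else pascal a n k - pascal a n m * pathProduct c m k := by
    intro m
    induction m with
    | zero => simp
    | succ m ih =>
      rw [Finset.sum_range_succ, ih]
      have hab : abelTriangle (x + y) y n m =
          pascal a n m - y * ((m + 1) * pascal a n (m + 1)) := by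
        rw [← natCast_mul_pascal_pred]
        simp only [abelTriangle, Matrix.of_apply]
        rw [show x + y + n * y = a by rw [ha]; ring]
        ring
      rcases lt_trichotomy m k with h | h | h
      · rw [if_pos h.le, if_pos (by omega), pathProduct_eq_zero c h]; simp
      · subst h
        rw [if_pos le_rfl, hab, pathProduct_succ_left c le_rfl, if_neg (by omega),
          pathProduct_self, hc]
        ring
      · rw [if_neg (by omega), hab, pathProduct_succ_left c h.le, if_neg (by omega), hc]
        ring
  rw [hpart, if_neg (by omega), pascal_eq_zero a (by omega : n < N + 1), zero_mul, sub_zero]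
  rfl

/-- Pascal's rule with weight `a = x + (n + 1) y`, in which `x = a - (n + 1) y`. -/
theorem sum_treeTriangle_mul_bidiagonal (x y : R) {n N k : ℕ} (hk : k ≤ N) :
    ∑ j ∈ Finset.range (N + 1), treeTriangle x y n j * bidiagonal (fun _ => x) j k =
      abelTriangle x y (n + 1) k := by
  obtain _ | k := k
  · rw [sum_mul_bidiagonal_zero]
    simp only [treeTriangle, abelTriangle, Matrix.of_apply, Nat.add_sub_cancel, pascal_succ_zero]
    push_cast
    ring
  · rw [sum_mul_bidiagonal_succ _ _ hk]
    simp only [treeTriangle, abelTriangle, Matrix.of_apply, Nat.add_sub_cancel, pascal_succ_succ]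
    push_cast
    ring

/-- A truncation of the totally positive factor `binom * (n! / k!)` of the production matrices. -/
def treeFactor (N : ℕ) (y : R) : Matrix (Fin (N + 1)) (Fin (N + 1)) R :=
  leadingBlock N (pascal y) * leadingBlock N (pathProduct fun i : ℕ => (i + 1) * y)

theorem minorsMem_treeFactor {S : Subsemiring R} {y : R} (hy : y ∈ S) (N : ℕ) :
    (treeFactor N y).MinorsMem S :=
  ((minorsMem_pascal hy).leadingBlock N).mul ((minorsMem_pathProduct fun i =>
    mul_mem (add_mem (natCast_mem S i) (one_mem S)) hy).leadingBlock N)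

theorem abelTriangle_vecMul_treeFactor (x y : R) {n N : ℕ} (hn : n ≤ N) :
    (fun j : Fin (N + 1) => abelTriangle x y n j) ᵥ* treeFactor N y =
      fun j : Fin (N + 1) => treeTriangle x y n j := by
  have h1 : (fun j : Fin (N + 1) => abelTriangle x y n j) ᵥ* leadingBlock N (pascal y) =
      fun j : Fin (N + 1) => abelTriangle (x + y) y n j := by
    ext k
    rw [vecMul_leadingBlock, sum_abelTriangle_mul_pascal x y hn]
  ext k
  rw [treeFactor, ← vecMul_vecMul, h1, vecMul_leadingBlock,
    sum_abelTriangle_mul_pathProduct x y hn (by omega)]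

theorem treeTriangle_vecMul_bidiagonal (x y : R) (n N : ℕ) :
    (fun j : Fin (N + 1) => treeTriangle x y n j) ᵥ* leadingBlock N (bidiagonal fun _ => x) =
      fun j : Fin (N + 1) => abelTriangle x y (n + 1) j := by
  ext k
  rw [vecMul_leadingBlock, sum_treeTriangle_mul_bidiagonal x y (by omega)]

theorem abelTriangle_eq_pow (x y : R) (N : ℕ) : ∀ n ≤ N, ∀ k : Fin (N + 1),
    ((treeFactor N y * leadingBlock N (bidiagonal fun _ => x)) ^ n) 0 k =
      abelTriangle x y n k := by
  refine pow_zero_row_eq (fun k => ?_) fun n hn => ?_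
  · simp [abelTriangle, pascal_zero]
  · rw [← vecMul_vecMul, abelTriangle_vecMul_treeFactor x y hn.le,
      treeTriangle_vecMul_bidiagonal]

theorem treeTriangle_eq_pow (x y : R) (N : ℕ) : ∀ n ≤ N, ∀ k : Fin (N + 1),
    ((leadingBlock N (bidiagonal fun _ => x) * treeFactor N y) ^ n) 0 k =
      treeTriangle x y n k := by
  refine pow_zero_row_eq (fun k => ?_) fun n hn => ?_
  · simp [treeTriangle, pascal_zero]
  · rw [← vecMul_vecMul, treeTriangle_vecMul_bidiagonal,
      abelTriangle_vecMul_treeFactor x y (by omega)]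

variable {S : Subsemiring R} {x y : R}

theorem minorsMem_treeTriangle (hx : x ∈ S) (hy : y ∈ S) : (treeTriangle x y).MinorsMem S :=
  minorsMem_of_production _
    (fun N => ((minorsMem_bidiagonal fun _ => hx).leadingBlock N).mul (minorsMem_treeFactor hy N))
    (treeTriangle_eq_pow x y)

theorem minorsMem_hankelMatrix_tree (hx : x ∈ S) (hy : y ∈ S) :
    (hankelMatrix fun n : ℕ => (x + (n + 1) * y) ^ n).MinorsMem S := by
  refine minorsMem_hankelMatrix_of_production _
    (fun N => ((minorsMem_bidiagonal fun _ => hx).leadingBlock N).mul (minorsMem_treeFactor hy N))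
    fun N n hn => ?_
  rw [treeTriangle_eq_pow x y N n hn]
  simp [treeTriangle, pascal]

theorem minorsMem_hankelMatrix_abel (hx : x ∈ S) (hy : y ∈ S) :
    (hankelMatrix fun n : ℕ => if n = 0 then 1 else x * (x + n * y) ^ (n - 1)).MinorsMem S := by
  refine minorsMem_hankelMatrix_of_production _
    (fun N => (minorsMem_treeFactor hy N).mul ((minorsMem_bidiagonal fun _ => hx).leadingBlock N))
    fun N n hn => ?_
  rw [abelTriangle_eq_pow x y N n hn]
  obtain _ | n := n
  · simp [abelTriangle, pascal]
  · simp [abelTriangle, pascal, pow_succ]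
    ring

end Triangles

end Matrix

/-! ### The idempotent triangle. -/

namespace Matrix

section Idempotent

variable {R : Type*} [CommRing R]

/-- The numbers `binom(n, k) k^(n-k) k!`. -/
def idempotentTriangle (R : Type*) [CommRing R] : Matrix ℕ ℕ R :=
  Matrix.of fun n k => (n.choose k : R) * (k : R) ^ (n - k) * (k.factorial : R)

/-- The production matrix of the transpose of `idempotentTriangle`. -/
def idempotentProduction (R : Type*) [CommRing R] (N : ℕ) :
    Matrix (Fin (N + 1)) (Fin (N + 1)) R :=
  Matrix.of fun j n =>
    (leadingBlock N (pascal (1 : R))ᵀ * leadingBlock N (bidiagonal fun _ => (0 : R))) j n *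
      ((n : ℕ) : R)

theorem minorsMem_idempotentProduction (S : Subsemiring R) (N : ℕ) :
    (idempotentProduction R N).MinorsMem S :=
  ((((minorsMem_pascal (one_mem S)).transpose).leadingBlock N).mul
    ((minorsMem_bidiagonal fun _ => zero_mem S).leadingBlock N)).scale_cols
      fun n => natCast_mem S n

/-- Column `k` holds the coefficients of `t^n / n!` in `(t e^t)^k`. Multiplication by `t e^t` acts
on such coefficients through the matrix `n * binom(n-1, j)`, which is the production matrix. -/
theorem idempotentTriangle_eq_pow (N : ℕ) : ∀ k ≤ N, ∀ n : Fin (N + 1),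
    (idempotentProduction R N ^ k) 0 n = idempotentTriangle R n k := by
  refine pow_zero_row_eq (o := fun k n => idempotentTriangle R n k) (fun n => ?_) fun k _ => ?_
  · obtain _ | n := n <;> simp [idempotentTriangle]
  · ext n
    have hentry : ∀ j : Fin (N + 1), idempotentProduction R N j n =
        if (n : ℕ) = 0 then 0 else pascal (1 : R) (n - 1) j * ((n : ℕ) : R) := by
      intro j
      have h := vecMul_leadingBlock N (bidiagonal fun _ => (0 : R)) (fun i => pascal 1 i j) n
      simp only [vecMul, dotProduct] at h
      simp only [idempotentProduction, Matrix.of_apply, Matrix.mul_apply]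
      obtain ⟨n, hn⟩ := n
      change (∑ i : Fin (N + 1), pascal 1 i j * _) * _ = _
      rw [h]
      obtain _ | n := n
      · simp
      · rw [sum_mul_bidiagonal_succ _ _ (Nat.lt_succ_iff.1 hn)]
        simp
    simp only [vecMul, dotProduct, hentry]
    obtain ⟨n, hn⟩ := n
    obtain _ | n := n
    · simp [idempotentTriangle]
    · have h := sum_pascal_mul_pascal (1 : R) (k : R) (by omega : n ≤ N) k
      simp only [Nat.add_one_ne_zero, if_false, Nat.add_sub_cancel]
      rw [← Fin.sum_univ_eq_sum_range (fun j => pascal (1 : R) n j * pascal (k : R) j k)] at h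
      have hc := congrArg (Nat.cast (R := R)) (Nat.add_one_mul_choose_eq n k)
      push_cast at hc
      calc _ = (∑ j : Fin (N + 1), pascal (1 : R) n j * pascal (k : R) j k) *
            ((n + 1) * k.factorial) := by
            rw [Finset.sum_mul]
            refine Finset.sum_congr rfl fun j _ => ?_
            simp only [idempotentTriangle, pascal, Matrix.of_apply]
            push_cast
            ring
        _ = _ := by
            rw [h]
            simp only [idempotentTriangle, pascal, Matrix.of_apply, Nat.factorial_succ,
              Nat.add_sub_add_right]
            push_cast
            linear_combination (1 + (k : R)) ^ (n - k) * k.factorial * hc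

theorem minorsMem_idempotentTriangle (S : Subsemiring R) :
    (idempotentTriangle R).MinorsMem S := by
  have : (idempotentTriangle R)ᵀ.MinorsMem S :=
    minorsMem_of_production _ (minorsMem_idempotentProduction S) idempotentTriangle_eq_pow
  exact this.transpose

end Idempotent

end Matrix

/-! ### Total positivity and log-convexity over the reals and polynomials. -/

theorem Matrix.MinorsMem.isTotallyPositive {m n : Type*} [Preorder m] [Preorder n]
    {M : Matrix m n ℝ} (h : M.MinorsMem (Subsemiring.nonneg ℝ)) : IsTotallyPositive M :=
  fun r _ _ hr hc => h r _ _ hr hc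

theorem isTotallyPositive_idempotent :
    IsTotallyPositive (Matrix.of fun n k : ℕ => (n.choose k : ℝ) * (k : ℝ) ^ (n - k)) := by
  have := (Matrix.minorsMem_idempotentTriangle (Subsemiring.nonneg ℝ)).scale_cols
    (c := fun k => ((k.factorial : ℝ))⁻¹) fun k => by
      rw [Subsemiring.mem_nonneg]; positivity
  refine Matrix.MinorsMem.isTotallyPositive ?_
  convert this using 1
  ext n k
  have : (k.factorial : ℝ) ≠ 0 := by positivity
  simp [Matrix.idempotentTriangle, mul_assoc, this]

/-- This is `treeTriangle 0 1` with both indices shifted by one. -/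
theorem minorsMem_inverseIdempotent : (Matrix.of fun n k : ℕ+ =>
    (((n : ℕ) - 1).choose ((k : ℕ) - 1) : ℝ) *
      ((n : ℕ) : ℝ) ^ ((n : ℕ) - (k : ℕ))).MinorsMem (Subsemiring.nonneg ℝ) := by
  have h := Matrix.minorsMem_treeTriangle (S := Subsemiring.nonneg ℝ) (zero_mem _) (one_mem _)
  have hmono : StrictMono PNat.natPred := PNat.natPred_strictMono
  convert h.submatrix hmono hmono using 1
  ext n k
  have hn : ((PNat.natPred n : ℕ) : ℝ) + 1 = (n : ℕ) := by
    exact_mod_cast PNat.natPred_add_one n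
  have e : (n : ℕ) - (k : ℕ) = n.natPred - k.natPred := by
    have := PNat.natPred_add_one n
    have := PNat.natPred_add_one k
    omega
  simp only [Matrix.submatrix_apply, Matrix.treeTriangle, Matrix.pascal, Matrix.of_apply, zero_add,
    mul_one, hn, e]
  rfl

theorem isTotallyPositive_inverseIdempotent_factorial :
    IsTotallyPositive (Matrix.of fun n k : ℕ+ =>
        (((n : ℕ) - 1).choose ((k : ℕ) - 1) : ℝ) * ((n : ℕ) : ℝ) ^ ((n : ℕ) - (k : ℕ)) *
          ((k : ℕ).factorial : ℝ)) :=
  (minorsMem_inverseIdempotent.scale_cols fun k => by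
    rw [Subsemiring.mem_nonneg]; positivity).isTotallyPositive

/-- The semiring of real polynomials with nonnegative coefficients. -/
def nonnegCoeffs : Subsemiring ℝ[X] where
  carrier := {p | HasNonnegCoeffs p}
  mul_mem' {p q} hp hq i := by
    rw [coeff_mul]
    exact Finset.sum_nonneg fun _ _ => mul_nonneg (hp _) (hq _)
  one_mem' i := by
    rw [coeff_one]; split_ifs <;> norm_num
  add_mem' {p q} hp hq i := by
    rw [coeff_add]; exact add_nonneg (hp i) (hq i)
  zero_mem' i := by simp

theorem X_mem_nonnegCoeffs : (X : ℝ[X]) ∈ nonnegCoeffs := fun i => by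
  rw [coeff_X]; split_ifs <;> norm_num

/-- Three-fold log-convexity follows from the positivity of Hankel minors of size up to `4`. -/
theorem isKQLogConvex_three_of_minorsMem {a : ℕ → ℝ[X]}
    (h : (hankelMatrix a).MinorsMem nonnegCoeffs) : IsKQLogConvex 3 a := by
  have minor : ∀ r i : ℕ, (Matrix.of fun p q : Fin r => a (i + p + q)).det ∈ nonnegCoeffs :=
    fun r i => h r (fun p => i + p) (fun q => q) (fun _ _ hpq => by simpa using hpq)
      (fun _ _ hpq => hpq)
  have h1 : ∀ i, a i ∈ nonnegCoeffs := fun i => by simpa using minor 1 i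
  have h2 : ∀ i, a i * a (i + 2) - a (i + 1) ^ 2 ∈ nonnegCoeffs := fun i => by
    convert minor 2 i using 1
    simp [Matrix.det_fin_two, add_assoc]
    ring
  set d3 : ℕ → ℝ[X] := fun i => a i * a (i + 2) * a (i + 4) + 2 * (a (i + 1) * a (i + 2) * a (i + 3))
    - a (i + 2) ^ 3 - a i * a (i + 3) ^ 2 - a (i + 1) ^ 2 * a (i + 4) with hd3
  have h3 : ∀ i, d3 i ∈ nonnegCoeffs := fun i => by
    convert minor 3 i using 1
    simp [Matrix.det_fin_three, add_assoc, hd3]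
    ring
  -- Dodgson condensation: `d3 i` is the 3 × 3 Hankel minor, and `a (i + 2)` its central entry.
  have e2 : ∀ i, logConvexOp (logConvexOp a) i = a (i + 2) * d3 i := fun i => by
    simp only [logConvexOp, hd3]
    ring_nf
  have e3 : ∀ i, logConvexOp (logConvexOp (logConvexOp a)) i =
      a (i + 2) * a (i + 4) * ((Matrix.of fun p q : Fin 4 => a (i + p + q)).det *
        (a (i + 2) * a (i + 2 + 2) - a (i + 2 + 1) ^ 2)) +
      (a (i + 2) * a (i + 2 + 2) - a (i + 2 + 1) ^ 2) * d3 (i + 1) ^ 2 := fun i => by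
    -- Condensation again, for the 4 × 4 minor with its central 2 × 2 minor.
    have e4 : (Matrix.of fun p q : Fin 4 => a (i + p + q)).det *
        (a (i + 2) * a (i + 2 + 2) - a (i + 2 + 1) ^ 2) = d3 i * d3 (i + 2) - d3 (i + 1) ^ 2 := by
      rw [Matrix.det_succ_row_zero]
      simp [Fin.sum_univ_succ, Matrix.det_fin_three, Fin.succAbove, add_assoc, hd3]
      ring
    rw [e4]
    change logConvexOp (logConvexOp a) i * logConvexOp (logConvexOp a) (i + 2) -
      logConvexOp (logConvexOp a) (i + 1) ^ 2 = _
    rw [e2, e2, e2]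
    simp only [add_assoc, Nat.reduceAdd]
    ring
  intro m hm i
  interval_cases m
  · exact h1 i
  · exact h2 i
  · change logConvexOp (logConvexOp a) i ∈ nonnegCoeffs
    rw [e2]
    exact mul_mem (h1 _) (h3 _)
  · change logConvexOp (logConvexOp (logConvexOp a)) i ∈ nonnegCoeffs
    rw [e3]
    exact add_mem (mul_mem (mul_mem (h1 _) (h1 _)) (mul_mem (minor 4 i) (h2 _)))
      (mul_mem (h2 _) (pow_mem (h3 _) 2))

theorem inverseIdempotentPoly_eq :
    inverseIdempotentPoly = fun n : ℕ => if n = 0 then 1 else X * (X + (n : ℝ[X]) * 1) ^ (n - 1) := by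
  funext n
  obtain _ | n := n
  · simp [inverseIdempotentPoly]
  · have : (X : ℝ[X]) + ((n + 1 : ℕ) : ℝ[X]) * 1 = X + C ((n + 1 : ℕ) : ℝ) := by simp
    simp only [inverseIdempotentPoly, Nat.add_one_ne_zero, if_false, Nat.add_sub_cancel]
    rw [this, add_pow, Finset.mul_sum, Finset.range_eq_Ico,
      ← Finset.sum_Ico_add_right_sub_eq 0 (n + 1) 1]
    refine Finset.sum_congr rfl fun k hk => ?_
    obtain ⟨hk1, hk2⟩ := Finset.mem_Icc.1 hk
    obtain ⟨k, rfl⟩ := Nat.exists_eq_add_of_le' hk1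
    simp only [Nat.add_sub_cancel, Nat.add_sub_add_right, C_mul, C_pow, pow_succ, map_natCast]
    ring

theorem minorsMem_hankelMatrix_inverseIdempotentPoly :
    (hankelMatrix inverseIdempotentPoly).MinorsMem nonnegCoeffs := by
  rw [inverseIdempotentPoly_eq]
  exact Matrix.minorsMem_hankelMatrix_abel X_mem_nonnegCoeffs (one_mem _)

theorem minorsMem_hankelMatrix_reversedAbel :
    (hankelMatrix fun i : ℕ => ((1 + X * C ((i : ℝ) + 1)) ^ i : ℝ[X])).MinorsMem nonnegCoeffs := by
  convert Matrix.minorsMem_hankelMatrix_tree (one_mem nonnegCoeffs) X_mem_nonnegCoeffs using 5 with i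
  simp [mul_comm]

/-! ### From Hankel minors to positivity on the half-line. -/

/-- A real matrix with nonnegative principal minors has `det (1 + s M) > 0` for `s ≥ 0`. -/
theorem Matrix.det_one_add_smul_pos {n : Type*} [Fintype n] [DecidableEq n] (M : Matrix n n ℝ)
    (h : ∀ s : Finset n, 0 ≤ (M.submatrix (Subtype.val : s → n) (Subtype.val : s → n)).det)
    {s : ℝ} (hs : 0 ≤ s) : 0 < (1 + s • M).det := by
  set p : ℝ[X] := det (1 + (X : ℝ[X]) • M.map C) with hp
  have heval : p.eval s = (1 + s • M).det := by
    rw [hp, ← coe_evalRingHom, RingHom.map_det]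
    congr 1
    ext i j
    simp only [RingHom.mapMatrix_apply, map_apply, add_apply, smul_apply, smul_eq_mul,
      coe_evalRingHom, eval_add, eval_mul, eval_X, eval_C, one_apply]
    split_ifs <;> simp
  have hcoeff : ∀ k, 0 ≤ p.coeff k := fun k => by
    rw [hp, Matrix.coeff_det_one_add_X_smul_eq_sum_minors]
    exact Finset.sum_nonneg fun t _ => h t
  have h0 : p.coeff 0 = 1 := by
    rw [hp, Matrix.coeff_det_one_add_X_smul_eq_sum_minors]
    simp
  rw [← heval, eval_eq_sum_range]
  refine lt_of_lt_of_le one_pos ?_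
  have := Finset.single_le_sum (f := fun i => p.coeff i * s ^ i)
    (fun i _ => mul_nonneg (hcoeff i) (pow_nonneg hs i)) (Finset.mem_range.2 (Nat.succ_pos p.natDegree))
  simpa [h0] using this

/-- A real symmetric matrix with nonnegative principal minors is positive semidefinite. -/
theorem Matrix.posSemidef_of_principal_minors {n : Type*} [Fintype n] [DecidableEq n]
    {M : Matrix n n ℝ} (hM : M.IsHermitian)
    (h : ∀ s : Finset n, 0 ≤ (M.submatrix (Subtype.val : s → n) (Subtype.val : s → n)).det) :
    M.PosSemidef := by
  rw [hM.posSemidef_iff_eigenvalues_nonneg]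
  intro i
  by_contra hneg
  simp only [Pi.zero_apply, not_le] at hneg
  -- For an eigenvalue `λ < 0`, taking `s = -1/λ` makes `1 + s M` kill the eigenvector.
  have hpos := M.det_one_add_smul_pos h (s := (-hM.eigenvalues i)⁻¹)
    (inv_nonneg.2 (by linarith))
  refine hpos.ne' (Matrix.exists_mulVec_eq_zero_iff.1 ⟨⇑(hM.eigenvectorBasis i), ?_, ?_⟩)
  · intro h0
    apply hM.eigenvectorBasis.orthonormal.ne_zero i
    ext j
    exact congrFun h0 j
  · rw [add_mulVec, one_mulVec, smul_mulVec, hM.mulVec_eigenvectorBasis, smul_smul,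
      inv_neg, neg_mul, inv_mul_cancel₀ hneg.ne]
    simp

/-- The linear functional `X ^ n ↦ a n` on polynomials. -/
noncomputable def rieszFunctional (a : ℕ → ℝ) : ℝ[X] →ₗ[ℝ] ℝ :=
  Polynomial.lsum fun n => LinearMap.toSpanSingleton ℝ ℝ (a n)

theorem rieszFunctional_apply (a : ℕ → ℝ) (p : ℝ[X]) :
    rieszFunctional a p = ∑ n ∈ Finset.range (p.natDegree + 1), p.coeff n * a n := by
  rw [rieszFunctional, lsum_apply, sum_over_range]
  · simp
  · simp

theorem rieszFunctional_monomial (a : ℕ → ℝ) (n : ℕ) (c : ℝ) :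
    rieszFunctional a (monomial n c) = c * a n := by
  simp [rieszFunctional, lsum_apply]

theorem rieszFunctional_X_mul (a : ℕ → ℝ) (p : ℝ[X]) :
    rieszFunctional a (X * p) = rieszFunctional (fun n => a (n + 1)) p := by
  have : rieszFunctional a ∘ₗ LinearMap.mulLeft ℝ X = rieszFunctional fun n => a (n + 1) := by
    ext n
    simp [rieszFunctional_monomial, X_mul_monomial]
  exact LinearMap.congr_fun this p

/-- The value at `p ^ 2` is the Hankel quadratic form at the coefficient vector of `p`. -/
theorem rieszFunctional_sq_nonneg {a : ℕ → ℝ}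
    (h : (hankelMatrix a).MinorsMem (Subsemiring.nonneg ℝ)) (p : ℝ[X]) :
    0 ≤ rieszFunctional a (p ^ 2) := by
  set N := p.natDegree + 1 with hN
  set H : Matrix (Fin N) (Fin N) ℝ := (hankelMatrix a).submatrix Fin.val Fin.val with hH
  have hpsd : H.PosSemidef := by
    apply Matrix.posSemidef_of_principal_minors
    · ext i j
      simp [hH, hankelMatrix, add_comm]
    · intro s
      set e := s.orderIsoOfFin rfl
      rw [← Matrix.det_submatrix_equiv_self e.toEquiv]
      exact h s.card (fun i => (e i : Fin N)) (fun i => (e i : Fin N))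
        (fun _ _ hij => e.strictMono hij) (fun _ _ hij => e.strictMono hij)
  have h2 := hpsd.dotProduct_mulVec_nonneg (fun i : Fin N => p.coeff i)
  have hp : p = ∑ i : Fin N, monomial i (p.coeff i) := by
    rw [Fin.sum_univ_eq_sum_range (fun i => monomial i (p.coeff i))]
    exact p.as_sum_range
  have hsq : p ^ 2 = (∑ i : Fin N, monomial i (p.coeff i)) *
      ∑ i : Fin N, monomial i (p.coeff i) := by rw [← hp, sq]
  refine h2.trans_eq ?_
  rw [hsq, Finset.sum_mul_sum]
  simp only [map_sum, monomial_mul_monomial, rieszFunctional_monomial, dotProduct, Matrix.mulVec,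
    Finset.mul_sum]
  refine Finset.sum_congr rfl fun i _ => Finset.sum_congr rfl fun j _ => ?_
  simp [hH, hankelMatrix]
  ring

theorem eval_nonneg_of_forall_ne {r : ℝ[X]} {x₀ : ℝ}
    (h : ∀ x, 0 ≤ x → x ≠ x₀ → 0 ≤ r.eval x) : ∀ x, 0 ≤ x → 0 ≤ r.eval x := by
  intro x hx
  by_cases hne : x = x₀
  · subst hne
    refine ge_of_tendsto (f := fun y => r.eval y) (x := nhdsWithin x (Set.Ioi x))
      (r.continuous.continuousWithinAt) ?_
    filter_upwards [self_mem_nhdsWithin] with y hy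
    have hy' : x < y := hy
    exact h y (hx.trans hy'.le) hy'.ne'
  · exact h x hx hne

theorem exists_min_of_nonneg {p : ℝ[X]} (hdeg : 0 < p.natDegree)
    (hp : ∀ x, 0 ≤ x → 0 ≤ p.eval x) : ∃ x₀, 0 ≤ x₀ ∧ ∀ x, 0 ≤ x → p.eval x₀ ≤ p.eval x := by
  have hdeg' : 0 < p.degree := natDegree_pos_iff_degree_pos.1 hdeg
  have hlim : Filter.Tendsto (fun x => p.eval x) Filter.atTop Filter.atTop := by
    rcases le_total 0 p.leadingCoeff with h | h
    · exact p.tendsto_atTop_of_leadingCoeff_nonneg hdeg' h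
    · exfalso
      have := p.tendsto_atBot_of_leadingCoeff_nonpos hdeg' h
      obtain ⟨x, hx1, hx2⟩ :=
        ((this.eventually (Filter.eventually_lt_atBot 0)).and (Filter.eventually_ge_atTop 0)).exists
      exact absurd (hp x hx2) (not_le.2 hx1)
  obtain ⟨x₀, hx₀, hmin⟩ := ContinuousOn.exists_isMinOn' (f := fun x => p.eval x)
    (s := Set.Ici 0) p.continuous.continuousOn isClosed_Ici (x₀ := 0) (by simp) (by
      rw [cocompact_eq_atBot_atTop, inf_comm, inf_sup_left, Filter.eventually_sup]
      constructor
      · rw [inf_comm, Filter.eventually_inf_principal]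
        filter_upwards [Filter.eventually_lt_atBot 0] with x hx hx'
        exact absurd hx' (not_le.2 hx)
      · exact Filter.Eventually.filter_mono inf_le_right
          (hlim.eventually (Filter.eventually_ge_atTop _)))
  exact ⟨x₀, hx₀, fun x hx => hmin hx⟩

/-- A functional which is nonnegative on `q²` and `X q²` is nonnegative on all polynomials
that are nonnegative on the half-line. -/
theorem functional_nonneg_of_nonneg_on_halfLine (n : ℕ) : ∀ (p : ℝ[X]), p.natDegree ≤ n →
    (∀ x, 0 ≤ x → 0 ≤ p.eval x) → ∀ L : ℝ[X] →ₗ[ℝ] ℝ, (∀ q, 0 ≤ L (q ^ 2)) →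
    (∀ q, 0 ≤ L (X * q ^ 2)) → 0 ≤ L p := by
  induction n using Nat.strong_induction_on with
  | _ n ih =>
    intro p hpn hp L hL hL'
    have hconst : ∀ c : ℝ, 0 ≤ c → 0 ≤ L (C c) := fun c hc => by
      have := hL (C (Real.sqrt c))
      rwa [← C_pow, Real.sq_sqrt hc] at this
    rcases Nat.eq_zero_or_pos p.natDegree with hdeg | hdeg
    · rw [eq_C_of_natDegree_eq_zero hdeg] at hp ⊢
      exact hconst _ (by simpa using hp 0 le_rfl)
    obtain ⟨x₀, hx₀, hmin⟩ := exists_min_of_nonneg hdeg hp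
    -- Subtracting the minimum creates a root on the half-line, which lowers the degree; the factor
    -- split off is absorbed into the functional.
    set m := p.eval x₀
    set q := p - C m with hq
    have hqdeg : q.natDegree = p.natDegree := natDegree_sub_C
    have hq0 : q ≠ 0 := fun h => by rw [h] at hqdeg; simp at hqdeg; omega
    have hqx : ∀ x, 0 ≤ x → 0 ≤ q.eval x := fun x hx => by simpa [hq] using hmin x hx
    have hroot : q.IsRoot x₀ := by simp [hq, m]
    have hsplit : L p = L (C m) + L q := by rw [← map_add, hq]; congr 1; ring
    rw [hsplit]
    refine add_nonneg (hconst m (hp x₀ hx₀)) ?_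
    rcases hx₀.eq_or_lt with h0 | h0
    · obtain ⟨r, hr⟩ := dvd_iff_isRoot.2 hroot
      rw [← h0, C_0, sub_zero] at hr
      have hr0 : r ≠ 0 := fun h => hq0 (by rw [hr, h, mul_zero])
      have hrdeg : r.natDegree < n := by
        rw [hr, natDegree_X_mul hr0] at hqdeg
        omega
      rw [hr]
      -- For `L (X * ·)` the two hypotheses trade places, since `X * (X * s²) = (X * s)²`.
      refine ih r.natDegree hrdeg r le_rfl (eval_nonneg_of_forall_ne (x₀ := 0) fun x hx hx' => ?_)
        (L ∘ₗ LinearMap.mulLeft ℝ X) (fun s => hL' s) (fun s => ?_)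
      · have := hqx x hx
        rw [hr, eval_mul, eval_X] at this
        exact nonneg_of_mul_nonneg_right this (lt_of_le_of_ne hx hx'.symm)
      · have := hL (X * s)
        rw [mul_pow, sq X, mul_assoc] at this
        exact this
    · have hder : q.derivative.IsRoot x₀ := by
        have hloc : IsLocalMin (fun x => q.eval x) x₀ := by
          filter_upwards [Ioi_mem_nhds h0] with x hx
          have := hqx x (le_of_lt hx)
          rwa [← hroot.eq_zero] at this
        exact hloc.hasDerivAt_eq_zero (q.hasDerivAt x₀)
      -- An interior minimum is a double root, so the square `(X - x₀)²` divides `q`.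
      have hmult := (one_lt_rootMultiplicity_iff_isRoot hq0).2 ⟨hroot, hder⟩
      obtain ⟨r, hr⟩ := (le_rootMultiplicity_iff hq0).1 hmult
      have hr0 : r ≠ 0 := fun h => hq0 (by rw [hr, h, mul_zero])
      have hrdeg : r.natDegree < n := by
        rw [hr, natDegree_mul (pow_ne_zero _ (X_sub_C_ne_zero x₀)) hr0, natDegree_pow,
          natDegree_X_sub_C] at hqdeg
        omega
      rw [hr]
      refine ih r.natDegree hrdeg r le_rfl (eval_nonneg_of_forall_ne (x₀ := x₀) fun x hx hx' => ?_)
        (L ∘ₗ LinearMap.mulLeft ℝ ((X - C x₀) ^ 2)) (fun s => ?_) (fun s => ?_)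
      · have := hqx x hx
        rw [hr, eval_mul] at this
        refine nonneg_of_mul_nonneg_right this ?_
        have : x - x₀ ≠ 0 := sub_ne_zero.2 hx'
        simp only [Nat.succ_eq_add_one, Nat.reduceAdd, eval_pow, eval_sub, eval_X, eval_C]
        positivity
      · have := hL ((X - C x₀) * s)
        rwa [mul_pow] at this
      · have := hL' ((X - C x₀) * s)
        rw [mul_pow, mul_left_comm] at this
        exact this

theorem rieszFunctional_nonneg_of_hankel {a : ℕ → ℝ}
    (h : (hankelMatrix a).MinorsMem (Subsemiring.nonneg ℝ)) {p : ℝ[X]}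
    (hp : ∀ x, 0 ≤ x → 0 ≤ p.eval x) : 0 ≤ rieszFunctional a p := by
  refine functional_nonneg_of_nonneg_on_halfLine _ p le_rfl hp _ (rieszFunctional_sq_nonneg h)
    fun q => ?_
  rw [rieszFunctional_X_mul]
  refine rieszFunctional_sq_nonneg ?_ q
  -- The Hankel matrix of the shifted sequence is the original without its first row.
  have := h.submatrix (f := fun i : ℕ => i + 1) (g := fun i : ℕ => i)
    (fun _ _ hij => by simpa using hij) (fun _ _ hij => hij)
  convert this using 1
  ext i j
  simp only [hankelMatrix, Matrix.of_apply, Matrix.submatrix_apply]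
  congr 1
  omega

/-! ### Representing measures on the half-line. -/

open MeasureTheory Filter Topology
open scoped NNReal CompactlySupported

/-- Functions on the half-line with at most polynomial growth. -/
def polynomialGrowth : Submodule ℝ (ℝ≥0 → ℝ) where
  carrier := {f | ∃ p : ℝ[X], ∀ x : ℝ≥0, |f x| ≤ p.eval (x : ℝ)}
  add_mem' := by
    rintro f g ⟨p, hp⟩ ⟨q, hq⟩
    refine ⟨p + q, fun x => ?_⟩
    rw [eval_add]
    exact (abs_add_le _ _).trans (add_le_add (hp x) (hq x))
  zero_mem' := ⟨0, by simp⟩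
  smul_mem' := by
    rintro c f ⟨p, hp⟩
    refine ⟨C |c| * p, fun x => ?_⟩
    rw [eval_mul, eval_C, Pi.smul_apply, smul_eq_mul, abs_mul]
    exact mul_le_mul_of_nonneg_left (hp x) (abs_nonneg c)

theorem abs_eval_le_eval (x : ℝ) (p : ℝ[X]) :
    |p.eval x| ≤ (1 + p ^ 2).eval x := by
  simp only [eval_add, eval_one, eval_pow]
  rw [abs_le]
  constructor <;> nlinarith [sq_nonneg (p.eval x - 1), sq_nonneg (p.eval x + 1)]

/-- Polynomials as functions on the half-line. -/
noncomputable def polynomialToFun : ℝ[X] →ₗ[ℝ] polynomialGrowth where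
  toFun p := ⟨fun x => p.eval (x : ℝ), 1 + p ^ 2, fun x => abs_eval_le_eval x p⟩
  map_add' p q := by ext x; simp
  map_smul' c p := by ext x; simp

theorem polynomialToFun_injective : Function.Injective polynomialToFun := by
  intro p q h
  refine eq_of_infinite_eval_eq p q ((Set.Ici_infinite (0 : ℝ)).mono fun x hx => ?_)
  have := congrFun (congrArg Subtype.val h) ⟨x, hx⟩
  exact this

/-- The cone of nonnegative functions of polynomial growth. -/
def nonnegGrowth : PointedCone ℝ polynomialGrowth where
  carrier := {f | ∀ x, 0 ≤ f.1 x}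
  add_mem' hf hg x := add_nonneg (hf x) (hg x)
  zero_mem' _ := le_rfl
  smul_mem' c _ hf x := mul_nonneg c.2 (hf x)

theorem exists_positive_extension {L : ℝ[X] →ₗ[ℝ] ℝ}
    (hL : ∀ p : ℝ[X], (∀ x, 0 ≤ x → 0 ≤ p.eval x) → 0 ≤ L p) :
    ∃ g : polynomialGrowth →ₗ[ℝ] ℝ, (∀ p, g (polynomialToFun p) = L p) ∧
      ∀ f : polynomialGrowth, (∀ x, 0 ≤ f.1 x) → 0 ≤ g f := by
  set e := LinearEquiv.ofInjective polynomialToFun polynomialToFun_injective with he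
  have hmk : ∀ p, e p = ⟨polynomialToFun p, LinearMap.mem_range_self _ p⟩ := fun p => rfl
  obtain ⟨g, hg1, hg2⟩ := riesz_extension nonnegGrowth
    ⟨LinearMap.range polynomialToFun, L ∘ₗ e.symm.toLinearMap⟩ (by
      intro f hf
      obtain ⟨p, rfl⟩ := e.surjective f
      change 0 ≤ L (e.symm (e p))
      rw [LinearEquiv.symm_apply_apply]
      exact hL p fun x hx => hf ⟨x, hx⟩) (by
      -- The cofinality condition of M. Riesz extension: the polynomial bound `p` of `|f|` makes `p
      -- + f` nonnegative.
      rintro ⟨f, p, hp⟩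
      refine ⟨e p, fun x => ?_⟩
      have := neg_abs_le (f x)
      have := hp x
      change 0 ≤ p.eval (x : ℝ) + f x
      linarith)
  refine ⟨g, fun p => ?_, hg2⟩
  have := hg1 (e p)
  rw [hmk] at this
  change g _ = L (e.symm (e p)) at this
  rwa [LinearEquiv.symm_apply_apply] at this

/-- Compactly supported continuous functions have polynomial growth. -/
noncomputable def compactlySupportedToFun : C_c(ℝ≥0, ℝ) →ₗ[ℝ] polynomialGrowth where
  toFun f := ⟨f, by
    obtain ⟨c, hc⟩ := f.hasCompactSupport.exists_bound_of_continuous f.continuous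
    exact ⟨C c, fun x => by simpa using hc x⟩⟩
  map_add' f g := rfl
  map_smul' c f := rfl

/-- The truncation of `x ^ k` to the interval `[0, N + 1]`. -/
noncomputable def truncatedPow (k N : ℕ) : C_c(ℝ≥0, ℝ) where
  toFun x := (x : ℝ) ^ k * max 0 (min 1 ((N : ℝ) + 1 - x))
  continuous_toFun := by fun_prop
  hasCompactSupport' := by
    refine HasCompactSupport.intro (isCompact_Icc (a := (0 : ℝ≥0)) (b := N + 1)) fun x hx => ?_
    have hx' : (N : ℝ) + 1 < x := by
      by_contra h
      refine hx ⟨zero_le, ?_⟩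
      rw [not_lt] at h
      exact_mod_cast h
    rw [min_eq_right (by linarith), max_eq_left (by linarith), mul_zero]

theorem truncatedPow_apply (k N : ℕ) (x : ℝ≥0) :
    truncatedPow k N x = (x : ℝ) ^ k * max 0 (min 1 ((N : ℝ) + 1 - x)) := rfl

theorem truncatedPow_nonneg (k N : ℕ) (x : ℝ≥0) : 0 ≤ truncatedPow k N x :=
  mul_nonneg (pow_nonneg x.2 k) (le_max_left _ _)

theorem truncatedPow_le (k N : ℕ) (x : ℝ≥0) : truncatedPow k N x ≤ (x : ℝ) ^ k :=
  mul_le_of_le_one_right (pow_nonneg x.2 k) (max_le zero_le_one (min_le_left _ _))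

theorem truncatedPow_eq {k N : ℕ} {x : ℝ≥0} (h : (x : ℝ) ≤ N) :
    truncatedPow k N x = (x : ℝ) ^ k := by
  rw [truncatedPow_apply, min_eq_left (by linarith), max_eq_right zero_le_one, mul_one]

theorem monotone_truncatedPow (k : ℕ) (x : ℝ≥0) : Monotone fun N => truncatedPow k N x := by
  intro M N h
  have : (M : ℝ) ≤ N := by exact_mod_cast h
  simp only [truncatedPow_apply]
  gcongr

/-- The measure represents the extended functional only on compactly supported functions; its
moments are recovered from the truncated powers by monotone convergence. -/
theorem exists_measure_of_positive_functional {L : ℝ[X] →ₗ[ℝ] ℝ}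
    (hL : ∀ p : ℝ[X], (∀ x, 0 ≤ x → 0 ≤ p.eval x) → 0 ≤ L p) :
    ∃ μ : Measure ℝ≥0, ∀ k : ℕ, Integrable (fun x : ℝ≥0 => (x : ℝ) ^ k) μ ∧
      ∫ x : ℝ≥0, (x : ℝ) ^ k ∂μ = L (X ^ k) := by
  obtain ⟨g, hg, hpos⟩ := exists_positive_extension hL
  let Λ : C_c(ℝ≥0, ℝ) →ₚ[ℝ] ℝ := PositiveLinearMap.mk₀ (g ∘ₗ compactlySupportedToFun)
    fun f hf => hpos _ fun x => hf x
  have hmono : ∀ f h : polynomialGrowth, (∀ x, f.1 x ≤ h.1 x) → g f ≤ g h := fun f h hfh => by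
    have := hpos (h - f) fun x => sub_nonneg.2 (hfh x)
    rw [map_sub] at this
    linarith
  set μ := RealRMK.rieszMeasure Λ
  have hint : ∀ k N, ∫ x, truncatedPow k N x ∂μ =
      g (compactlySupportedToFun (truncatedPow k N)) :=
    fun k N => RealRMK.integral_rieszMeasure Λ _
  refine ⟨μ, fun k => ?_⟩
  have hle : ∀ N, g (compactlySupportedToFun (truncatedPow k N)) ≤ L (X ^ k) := fun N => by
    rw [← hg]
    refine hmono _ _ fun x => ?_
    have : (polynomialToFun (X ^ k)).1 x = (x : ℝ) ^ k := by simp [polynomialToFun]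
    rw [this]
    exact truncatedPow_le k N x
  -- No mass escapes to infinity: beyond `N + 1`, `x^k ≤ x^(k+1) / (N + 1)`, so the next moment
  -- controls the tail.
  have hge : ∀ N : ℕ, L (X ^ k) - ((N : ℝ) + 1)⁻¹ * L (X ^ (k + 1)) ≤
      g (compactlySupportedToFun (truncatedPow k (N + 1))) := fun N => by
    rw [← hg, ← hg, ← smul_eq_mul, ← map_smul, ← map_sub]
    refine hmono _ _ fun x => ?_
    have : (polynomialToFun (X ^ k) - ((N : ℝ) + 1)⁻¹ • polynomialToFun (X ^ (k + 1))).1 x =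
        (x : ℝ) ^ k - ((N : ℝ) + 1)⁻¹ * (x : ℝ) ^ (k + 1) := by simp [polynomialToFun]
    rw [this]
    change _ ≤ truncatedPow k (N + 1) x
    have hx : (0 : ℝ) ≤ x := x.2
    rcases le_or_gt (x : ℝ) ((N + 1 : ℕ) : ℝ) with h | h
    · rw [truncatedPow_eq h]
      have : 0 ≤ ((N : ℝ) + 1)⁻¹ * (x : ℝ) ^ (k + 1) := by positivity
      linarith
    · refine le_trans ?_ (truncatedPow_nonneg k (N + 1) x)
      push_cast at h
      rw [pow_succ, sub_nonpos]
      have h1 : 1 ≤ ((N : ℝ) + 1)⁻¹ * x := by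
        rw [inv_mul_eq_div, one_le_div (by positivity)]; exact h.le
      calc (x : ℝ) ^ k = x ^ k * 1 := (mul_one _).symm
        _ ≤ x ^ k * (((N : ℝ) + 1)⁻¹ * x) := by gcongr
        _ = _ := by ring
  have hlim : Tendsto (fun N => g (compactlySupportedToFun (truncatedPow k N))) atTop
      (𝓝 (L (X ^ k))) := by
    rw [← tendsto_add_atTop_iff_nat 1]
    refine tendsto_of_tendsto_of_tendsto_of_le_of_le ?_ tendsto_const_nhds hge fun N => hle _
    have h0 : Tendsto (fun N : ℕ => ((N : ℝ) + 1)⁻¹) atTop (𝓝 0) := by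
      simpa only [one_div] using tendsto_one_div_add_atTop_nhds_zero_nat (𝕜 := ℝ)
    simpa using tendsto_const_nhds.sub (h0.mul_const (L (X ^ (k + 1))))
  have hlint : ∀ N, ∫⁻ x, ENNReal.ofReal (truncatedPow k N x) ∂μ =
      ENNReal.ofReal (g (compactlySupportedToFun (truncatedPow k N))) := fun N => by
    rw [← hint, ofReal_integral_eq_lintegral_ofReal]
    · exact (truncatedPow k N).continuous.integrable_of_hasCompactSupport
        (truncatedPow k N).hasCompactSupport
    · exact Eventually.of_forall (truncatedPow_nonneg k N)
  have hmct := lintegral_tendsto_of_tendsto_of_monotone (μ := μ)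
    (f := fun N x => ENNReal.ofReal (truncatedPow k N x))
    (F := fun x => ENNReal.ofReal ((x : ℝ) ^ k))
    (fun N => (truncatedPow k N).continuous.measurable.ennreal_ofReal.aemeasurable)
    (Eventually.of_forall fun x M N h => ENNReal.ofReal_le_ofReal (monotone_truncatedPow k x h))
    (Eventually.of_forall fun x => by
      refine tendsto_const_nhds.congr' ?_
      obtain ⟨M, hM⟩ := exists_nat_ge (x : ℝ)
      filter_upwards [eventually_ge_atTop M] with N hN
      rw [truncatedPow_eq (hM.trans (by exact_mod_cast hN))])
  simp only [hlint] at hmct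
  have hval := tendsto_nhds_unique hmct ((ENNReal.continuous_ofReal.tendsto _).comp hlim)
  have hnn : 0 ≤ᵐ[μ] fun x : ℝ≥0 => (x : ℝ) ^ k := Eventually.of_forall fun x => pow_nonneg x.2 k
  have hmeas : AEStronglyMeasurable (fun x : ℝ≥0 => (x : ℝ) ^ k) μ :=
    (by fun_prop : Continuous fun x : ℝ≥0 => (x : ℝ) ^ k).aestronglyMeasurable
  refine ⟨(lintegral_ofReal_ne_top_iff_integrable hmeas hnn).1 (by rw [hval]; simp), ?_⟩
  rw [integral_eq_lintegral_of_nonneg_ae hnn hmeas, hval, ENNReal.toReal_ofReal]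
  exact hL _ fun x hx => by simpa using pow_nonneg hx k

/-- **Stieltjes moment problem**: a sequence is a Stieltjes moment sequence as soon as its Riesz
functional is nonnegative on the polynomials that are nonnegative on the half-line. -/
theorem isStieltjesMoment_of_rieszFunctional_nonneg {a : ℕ → ℝ}
    (h : ∀ p : ℝ[X], (∀ x, 0 ≤ x → 0 ≤ p.eval x) → 0 ≤ rieszFunctional a p) :
    IsStieltjesMoment a := by
  obtain ⟨μ, hμ⟩ := exists_measure_of_positive_functional h
  refine ⟨μ.map ((↑) : ℝ≥0 → ℝ), fun k => ?_⟩
  have hm : Measurable ((↑) : ℝ≥0 → ℝ) := NNReal.continuous_coe.measurable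
  have hr : (μ.map ((↑) : ℝ≥0 → ℝ)).restrict (Set.Ici 0) = μ.map ((↑) : ℝ≥0 → ℝ) := by
    refine Measure.restrict_eq_self_of_ae_mem ?_
    refine (ae_map_iff (p := fun x => x ∈ Set.Ici (0 : ℝ)) hm.aemeasurable measurableSet_Ici).2 ?_
    exact Eventually.of_forall fun x => x.2
  have hk : AEStronglyMeasurable (fun x : ℝ => x ^ k) (μ.map ((↑) : ℝ≥0 → ℝ)) :=
    (continuous_pow k).aestronglyMeasurable
  obtain ⟨h1, h2⟩ := hμ k
  constructor
  · rw [IntegrableOn, hr, integrable_map_measure hk hm.aemeasurable]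
    exact h1
  · rw [hr, integral_map hm.aemeasurable hk, h2, ← monomial_one_right_eq_X_pow,
      rieszFunctional_monomial, one_mul]

theorem IsStieltjesMoment.rieszFunctional_nonneg {a : ℕ → ℝ} (ha : IsStieltjesMoment a)
    {p : ℝ[X]} (hp : ∀ x, 0 ≤ x → 0 ≤ p.eval x) : 0 ≤ rieszFunctional a p := by
  obtain ⟨μ, hμ⟩ := ha
  have : rieszFunctional a p = ∫ x in Set.Ici (0 : ℝ), p.eval x ∂μ := by
    simp only [eval_eq_sum_range, rieszFunctional_apply]
    rw [integral_finsetSum _ fun n _ => (hμ n).1.const_mul _]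
    refine Finset.sum_congr rfl fun n _ => ?_
    rw [integral_const_mul, (hμ n).2]
  rw [this]
  exact setIntegral_nonneg measurableSet_Ici fun x hx => hp x hx

theorem isStieltjesMoment_of_hankel {a : ℕ → ℝ}
    (h : (hankelMatrix a).MinorsMem (Subsemiring.nonneg ℝ)) : IsStieltjesMoment a :=
  isStieltjesMoment_of_rieszFunctional_nonneg fun _ hp => rieszFunctional_nonneg_of_hankel h hp

/-! ### Convolutions. -/

/-- A convolution preserves Stieltjes moment sequences if it does so for point masses. -/
theorem convolutionPreservesSM_of_hankel {A : ℕ → ℕ → ℝ}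
    (h : ∀ s t : ℝ, 0 ≤ s → 0 ≤ t → (hankelMatrix
      (triangleConvolution A (fun n => s ^ n) fun n => t ^ n)).MinorsMem (Subsemiring.nonneg ℝ)) :
    ConvolutionPreservesSM A := by
  intro x y hx hy
  refine isStieltjesMoment_of_rieszFunctional_nonneg fun p hp => ?_
  -- With `x` fixed, the value is the functional of `y` at a polynomial in `t`; positivity for `t ≥
  -- 0` suffices, and there `x` is replaced by the powers of `s` in the same way.
  have hright : rieszFunctional (triangleConvolution A x y) p = rieszFunctional y
      (∑ n ∈ Finset.range (p.natDegree + 1), ∑ k ∈ Finset.range (n + 1),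
        monomial (n - k) (p.coeff n * A n k * x k)) := by
    simp only [rieszFunctional_apply _ p, map_sum, rieszFunctional_monomial, triangleConvolution,
      Finset.mul_sum, mul_assoc]
  rw [hright]
  refine hy.rieszFunctional_nonneg fun t ht => ?_
  have hleft : (∑ n ∈ Finset.range (p.natDegree + 1), ∑ k ∈ Finset.range (n + 1),
        monomial (n - k) (p.coeff n * A n k * x k)).eval t = rieszFunctional x
      (∑ n ∈ Finset.range (p.natDegree + 1), ∑ k ∈ Finset.range (n + 1),
        monomial k (p.coeff n * A n k * t ^ (n - k))) := by
    simp only [eval_finsetSum, eval_monomial, map_sum, rieszFunctional_monomial]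
    exact Finset.sum_congr rfl fun n _ => Finset.sum_congr rfl fun k _ => by ring
  rw [hleft]
  refine hx.rieszFunctional_nonneg fun s hs => ?_
  have := rieszFunctional_nonneg_of_hankel (h s t hs ht) hp
  convert this using 1
  simp only [rieszFunctional_apply, triangleConvolution, eval_finsetSum, eval_monomial,
    Finset.mul_sum]
  exact Finset.sum_congr rfl fun n _ => Finset.sum_congr rfl fun k _ => by ring

theorem convolutionPreservesSM_tree : ConvolutionPreservesSM (fun n k : ℕ =>
    (n.choose k : ℝ) * ((n : ℝ) + 1) ^ (n - k)) := by
  refine convolutionPreservesSM_of_hankel fun s t hs ht => ?_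
  convert Matrix.minorsMem_hankelMatrix_tree (S := Subsemiring.nonneg ℝ) hs ht using 2
  funext n
  rw [triangleConvolution, add_pow]
  refine Finset.sum_congr rfl fun k _ => ?_
  rw [mul_pow]
  ring

theorem convolutionPreservesSM_inverseIdempotent : ConvolutionPreservesSM inverseIdempotent := by
  refine convolutionPreservesSM_of_hankel fun s t hs ht => ?_
  convert Matrix.minorsMem_hankelMatrix_abel (S := Subsemiring.nonneg ℝ) hs ht using 2
  funext n
  obtain _ | n := n
  · simp [triangleConvolution, inverseIdempotent]
  · rw [triangleConvolution, Finset.sum_range_succ']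
    simp only [Nat.add_one_ne_zero, if_false, Nat.add_sub_cancel, add_pow, Finset.mul_sum]
    simp only [inverseIdempotent, Nat.add_one_ne_zero, and_false, false_or, or_true, if_true,
      if_false, zero_mul, add_zero, Nat.add_sub_cancel, Nat.add_sub_add_right, false_and]
    refine Finset.sum_congr rfl fun k _ => ?_
    rw [mul_pow, pow_succ]
    ring

end

theorem mainTheorem12 :
    -- (i)
    (IsTotallyPositive (Matrix.of fun n k : ℕ => (n.choose k : ℝ) * (k : ℝ) ^ (n - k)) ∧
      IsTotallyPositive (Matrix.of fun n k : ℕ+ =>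
        (((n : ℕ) - 1).choose ((k : ℕ) - 1) : ℝ) * ((n : ℕ) : ℝ) ^ ((n : ℕ) - (k : ℕ)))) ∧
    -- (ii)
    (IsTotallyPositive (Matrix.of fun n k : ℕ =>
        (n.choose k : ℝ) * (k : ℝ) ^ (n - k) * (k.factorial : ℝ)) ∧
      IsTotallyPositive (Matrix.of fun n k : ℕ+ =>
        (((n : ℕ) - 1).choose ((k : ℕ) - 1) : ℝ) * ((n : ℕ) : ℝ) ^ ((n : ℕ) - (k : ℕ)) *
          ((k : ℕ).factorial : ℝ))) ∧
    -- (iii)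
    (IsQStieltjesMoment inverseIdempotentPoly ∧ IsKQLogConvex 3 inverseIdempotentPoly) ∧
    -- (iv): the sequence `(1 + q n)^(n - 1)`, `n ≥ 1`, with `n = i + 1`
    (IsQStieltjesMoment (fun i : ℕ => (1 + X * C ((i : ℝ) + 1)) ^ i) ∧
      IsKQLogConvex 3 (fun i : ℕ => (1 + X * C ((i : ℝ) + 1)) ^ i)) ∧
    -- (v): the sequence `n^(n - 1)`, `n ≥ 1`, with `n = i + 1`
    IsStieltjesMoment (fun i : ℕ => ((i : ℝ) + 1) ^ i) ∧
    -- (vi)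
    (ConvolutionPreservesSM inverseIdempotent ∧
      ConvolutionPreservesSM (fun n k : ℕ =>
        (n.choose k : ℝ) * ((n : ℝ) + 1) ^ (n - k))) := by
  refine ⟨⟨isTotallyPositive_idempotent, minorsMem_inverseIdempotent.isTotallyPositive⟩,
    ⟨(Matrix.minorsMem_idempotentTriangle _).isTotallyPositive,
      isTotallyPositive_inverseIdempotent_factorial⟩,
    ⟨minorsMem_hankelMatrix_inverseIdempotentPoly,
      isKQLogConvex_three_of_minorsMem minorsMem_hankelMatrix_inverseIdempotentPoly⟩,
    ⟨minorsMem_hankelMatrix_reversedAbel,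
      isKQLogConvex_three_of_minorsMem minorsMem_hankelMatrix_reversedAbel⟩, ?_,
    convolutionPreservesSM_inverseIdempotent, convolutionPreservesSM_tree⟩
  refine isStieltjesMoment_of_hankel ?_
  convert Matrix.minorsMem_hankelMatrix_tree (S := Subsemiring.nonneg ℝ) (zero_mem _) (one_mem _)
    using 4
  simp
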